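/- Let $n\ge 1$ and let $M$ be a compact complex manifold with $C^\infty$ boundary, $\dim_{\mathbb C}M=n$; that is, $M$ is a compact (Hausdorff) smooth real $2n$-dimensional manifold with boundary, covered by open sets with coordinate maps into $\mathbb C^n$ that are diffeomorphisms onto their images (smooth up to the boundary) and whose transition maps are holomorphic in the interior. Write $M^{\mathrm{int}}$ for the interior, $\mathcal O(M^{\mathrm{int}})$ for the functions holomorphic in $M^{\mathrm{int}}$, and $\mathcal O(M)=C^\infty(M)\cap\mathcal O(M^{\mathrm{int}})$, where $C^k(M)$ and $C^\infty(M)$ denote complex valued functions of that regularity up to the boundary. Assume that (a) $M$ is holomorphically separable: for all $x\ne y$ in $M$ there is $f\in\mathcal O(M)$ with $f(x)\ne f(y)$; (b) $M$ has local charts given by global holomorphic functions: for every $p\in M$ there are $f_1,\dots,f_n\in\mathcal O(M)$ which form a complex coordinate system near $p$. Let $k\ge 2$ be an integer. Then there is a dense subset $S\subset M$ such that for every $p\in S$ there are functions $\Phi\in C^k(M)\cap\mathcal O(M^{\mathrm{int}})$ and $a\in\mathcal O(M)$ with the following properties: $d\Phi(p)=0$; $\operatorname{Im}\Phi$ is a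 Morse function in $M$ (its Hessian is nondegenerate at each of its critical points in $M$, boundary points included), so that it has finitely many critical points $p,p_1,\dots,p_N$ in $M$; $a(p)=1$ and $a(p_1)=\dots=a(p_N)=0$; and for every $h>0$ both functions $e^{\Phi/h}a$ and $e^{-\Phi/h}a$ belong to $C^k(M)\cap\mathcal O(M^{\mathrm{int}})$. In particular $\Phi$ and $a$ do not depend on $h$. -/

import Mathlib

open scoped Manifold ContDiff

noncomputable section

namespace ComplexBdry

/-- A smooth coordinate system on a smooth manifold with boundary `M` of real dimension `2 * n`, with
values in `ℂⁿ`: a diffeomorphism, smooth up to the boundary, of an open subset of `M` onto its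
image. The image `e.target` is open in `ℂⁿ` only where the domain avoids the boundary, and the
image of the boundary may be any smooth real hypersurface. -/
structure IsSmoothChart {n : ℕ} [NeZero n] {M : Type*} [TopologicalSpace M]
    [ChartedSpace (EuclideanHalfSpace (2 * n)) M]
    (e : PartialEquiv M (Fin n → ℂ)) : Prop where
  isOpen_source : IsOpen e.source
  contMDiffOn_toFun : ContMDiffOn (𝓡∂ (2 * n)) 𝓘(ℝ, Fin n → ℂ) ∞ e e.source
  contMDiffOn_symm : ContMDiffOn 𝓘(ℝ, Fin n → ℂ) (𝓡∂ (2 * n)) ∞ e.symm e.target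

/-- The transition map `e' ∘ e⁻¹` is holomorphic (on the image of the interior of `M`, which is an
open subset of `ℂⁿ` when `e` is a smooth chart). -/
def HolomorphicTransition {n : ℕ} [NeZero n] {M : Type*} [TopologicalSpace M]
    [ChartedSpace (EuclideanHalfSpace (2 * n)) M]
    (e e' : PartialEquiv M (Fin n → ℂ)) : Prop :=
  DifferentiableOn ℂ (e' ∘ e.symm)
    (e '' (e.source ∩ e'.source ∩ (𝓡∂ (2 * n)).interior M))

/-- A structure of `n`-dimensional complex manifold with smooth boundary on a smooth manifold with
boundary `M` of real dimension `2 * n`: a covering of `M` by smooth charts with values in `ℂⁿ`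
whose transition maps are holomorphic. -/
structure ComplexStructure (n : ℕ) [NeZero n] (M : Type*) [TopologicalSpace M]
    [ChartedSpace (EuclideanHalfSpace (2 * n)) M] where
  atlas : Set (PartialEquiv M (Fin n → ℂ))
  isSmoothChart : ∀ e ∈ atlas, IsSmoothChart e
  cover : ∀ x : M, ∃ e ∈ atlas, x ∈ e.source
  compatible : ∀ e ∈ atlas, ∀ e' ∈ atlas, HolomorphicTransition e e'

namespace ComplexStructure

variable {n : ℕ} [NeZero n] {M : Type*} [TopologicalSpace M]
  [ChartedSpace (EuclideanHalfSpace (2 * n)) M]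

/-- `e` is a complex coordinate system on an open subset of `M`: a smooth chart that is
holomorphically compatible with all the charts of the complex structure. -/
def IsComplexChart (X : ComplexStructure n M) (e : PartialEquiv M (Fin n → ℂ)) : Prop :=
  IsSmoothChart e ∧ ∀ e' ∈ X.atlas, HolomorphicTransition e e' ∧ HolomorphicTransition e' e

/-- `f` is holomorphic in the interior of `M`. -/
def HolomorphicInterior (X : ComplexStructure n M) (f : M → ℂ) : Prop :=
  ∀ e ∈ X.atlas, DifferentiableOn ℂ (f ∘ e.symm) (e '' (e.source ∩ (𝓡∂ (2 * n)).interior M))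

/-- The set `C^k(M) ∩ 𝒪(M^int)` of functions that are `C^k` up to the boundary and holomorphic in
the interior. -/
def holC (X : ComplexStructure n M) (k : WithTop ℕ∞) : Set (M → ℂ) :=
  {f | ContMDiff (𝓡∂ (2 * n)) 𝓘(ℝ, ℂ) k f ∧ X.HolomorphicInterior f}

/-- The set `𝒪(M)` of functions that are smooth up to the boundary and holomorphic in the
interior. -/
def hol (X : ComplexStructure n M) : Set (M → ℂ) := X.holC ∞

/-- Functions in `𝒪(M)` separate the points of `M`. -/
def HolomorphicallySeparable (X : ComplexStructure n M) : Prop :=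
  ∀ x y : M, x ≠ y → ∃ f ∈ X.hol, f x ≠ f y

/-- Near every point of `M`, boundary points included, some `f₁, …, fₙ ∈ 𝒪(M)` form a complex
coordinate system. -/
def HasGlobalHolomorphicCharts (X : ComplexStructure n M) : Prop :=
  ∀ p : M, ∃ f : Fin n → M → ℂ, (∀ j, f j ∈ X.hol) ∧
    ∃ e : PartialEquiv M (Fin n → ℂ), X.IsComplexChart e ∧ p ∈ e.source ∧
      ∀ x ∈ e.source, ∀ j, e x j = f j x

end ComplexStructure

section Morse

variable {n : ℕ} [NeZero n] {M : Type*} [TopologicalSpace M]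
  [ChartedSpace (EuclideanHalfSpace (2 * n)) M]

/-- `p` is a critical point of the real function `u`. -/
def IsCriticalPoint (u : M → ℝ) (p : M) : Prop :=
  mfderiv (𝓡∂ (2 * n)) 𝓘(ℝ, ℝ) u p = 0

/-- The matrix of second derivatives of `u` at `p`, as a bilinear form, in the preferred (real)
coordinates at `p`; at a boundary point the derivatives are one-sided. At a critical point it is
the Hessian of `u`, and its nondegeneracy does not depend on the coordinates. -/
def hessianAt (u : M → ℝ) (p : M) :
    EuclideanSpace ℝ (Fin (2 * n)) →L[ℝ] EuclideanSpace ℝ (Fin (2 * n)) →L[ℝ] ℝ :=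
  fderivWithin ℝ
    (fderivWithin ℝ (u ∘ (extChartAt (𝓡∂ (2 * n)) p).symm) (Set.range (𝓡∂ (2 * n))))
    (Set.range (𝓡∂ (2 * n))) (extChartAt (𝓡∂ (2 * n)) p p)

/-- `u` is a Morse function in `M`: it is `C²` and all its critical points in `M`, those on the
boundary included, are nondegenerate. -/
def IsMorse (u : M → ℝ) : Prop :=
  ContMDiff (𝓡∂ (2 * n)) 𝓘(ℝ, ℝ) 2 u ∧
    ∀ p : M, IsCriticalPoint (n := n) u p →
      ∀ v : EuclideanSpace ℝ (Fin (2 * n)), (∀ w, hessianAt (n := n) u p v w = 0) → v = 0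

end Morse

end ComplexBdry

end

/-!
Let `G : M → ℂⁿ` have components in `𝒪(M)` and invertible differential near `q`. In the
coordinates `G` the differential of `f ∈ 𝒪(M)` is complex linear, also at boundary points since the
interior is dense, so it amounts to a gradient `grad G f` with values in `ℂⁿ`. The critical points
of `Im f` near `q` are the zeros of `grad G f`, and such a point is nondegenerate exactly when the
differential of `grad G f` is invertible there. Adding `a ⬝ᵥ G` to `f` adds the constant `a` to the
gradient, so by Sard's theorem `Im (f + a ⬝ᵥ G)` is Morse near `q` for a dense set of `a ∈ ℂⁿ`.

If `q ≠ p`, multiplying coordinates centred at `q` by the square of a function that vanishes at `p`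
but not at `q` gives coordinates near `q` whose differential vanishes at `p`, so the perturbation
keeps `p` critical. Being Morse on a compact set is stable under small perturbations. Starting from
half the sum of the squares of coordinates centred at `p`, finitely many perturbations therefore
give a `Φ ∈ 𝒪(M)` critical at `p` with `Im Φ` Morse on all of `M`. Its critical points are isolated,
hence finite in number, and a product of separating functions provides `a`.
-/

open scoped Topology

noncomputable section

namespace ComplexBdry

open Set Filter Function

section LinearAlgebra

lemma finrank_euclideanSpace_eq (n : ℕ) :
    Module.finrank ℝ (EuclideanSpace ℝ (Fin (2 * n))) = Module.finrank ℝ (Fin n → ℂ) := by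
  simp [Module.finrank_pi_fintype, Complex.finrank_real_complex, mul_comm]

lemma isInvertible_of_injective {𝕜 E F : Type*} [NontriviallyNormedField 𝕜] [CompleteSpace 𝕜]
    [NormedAddCommGroup E] [NormedSpace 𝕜 E] [FiniteDimensional 𝕜 E]
    [NormedAddCommGroup F] [NormedSpace 𝕜 F] [FiniteDimensional 𝕜 F]
    (hEF : Module.finrank 𝕜 E = Module.finrank 𝕜 F) {L : E →L[𝕜] F} (hL : Injective L) :
    L.IsInvertible :=
  ⟨(LinearEquiv.ofInjectiveOfFinrankEq (L : E →ₗ[𝕜] F) hL hEF).toContinuousLinearEquiv, rfl⟩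

end LinearAlgebra

/-! ### Derivatives in coordinates -/

section CoordinateDerivative

variable {𝕜 : Type*} [NontriviallyNormedField 𝕜]
  {E : Type*} [NormedAddCommGroup E] [NormedSpace 𝕜 E]
  {H : Type*} [TopologicalSpace H] (I : ModelWithCorners 𝕜 E H)
  {M : Type*} [TopologicalSpace M] [ChartedSpace H M]
  {V : Type*} [NormedAddCommGroup V] [NormedSpace 𝕜 V]
  {F : Type*} [NormedAddCommGroup F] [NormedSpace 𝕜 F]
  {F' : Type*} [NormedAddCommGroup F'] [NormedSpace 𝕜 F']
  {F'' : Type*} [NormedAddCommGroup F''] [NormedSpace 𝕜 F'']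

/-- The derivative of `g` at `x` expressed in the coordinates `G`, i.e. the derivative of
`g ∘ G⁻¹` at `G x`. It is `0` where the derivative of `G` is not invertible. -/
def coordDeriv (G : M → V) (g : M → F) (x : M) : V →L[𝕜] F :=
  mvfderiv I g x ∘L (mvfderiv I G x).inverse

variable {I} {G : M → V} {g : M → F} {x : M}

lemma hasFDerivWithinAt_comp_extChartAt_symm_self (hg : MDifferentiableAt I 𝓘(𝕜, F) g x) :
    HasFDerivWithinAt (g ∘ (extChartAt I x).symm) (mvfderiv I g x) (range I) (extChartAt I x x) :=
  hg.hasMFDerivAt.2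

lemma coordDeriv_comp_mvfderiv (hG : (mvfderiv I G x).IsInvertible) :
    coordDeriv I G g x ∘L mvfderiv I G x = mvfderiv I g x := by
  rw [coordDeriv, ContinuousLinearMap.comp_assoc, hG.inverse_comp_self,
    ContinuousLinearMap.comp_id]

lemma coordDeriv_mvfderiv_apply (hG : (mvfderiv I G x).IsInvertible) (v : TangentSpace I x) :
    coordDeriv I G g x (mvfderiv I G x v) = mvfderiv I g x v :=
  DFunLike.congr_fun (coordDeriv_comp_mvfderiv hG) v

lemma coordDeriv_self (hG : (mvfderiv I G x).IsInvertible) : coordDeriv I G G x = .id 𝕜 V :=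
  hG.self_comp_inverse

lemma isInvertible_coordDeriv_iff (hG : (mvfderiv I G x).IsInvertible) :
    (coordDeriv I G g x).IsInvertible ↔ (mvfderiv I g x).IsInvertible := by
  refine ⟨fun h ↦ ?_, fun h ↦ h.comp (.of_inverse hG.inverse_comp_self hG.self_comp_inverse)⟩
  rw [← coordDeriv_comp_mvfderiv hG]
  exact h.comp hG

lemma coordDeriv_eq_comp_inverse {T : E →L[𝕜] TangentSpace I x} (hT : T.IsInvertible) :
    coordDeriv I G g x = (mvfderiv I g x ∘L T) ∘L (mvfderiv I G x ∘L T).inverse := by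
  rw [hT.inverse_comp_of_right, coordDeriv, ContinuousLinearMap.comp_assoc,
    ← ContinuousLinearMap.comp_assoc T, hT.self_comp_inverse, ContinuousLinearMap.id_comp]

lemma mvfderiv_clm_comp (L : F →L[𝕜] F') (hg : MDifferentiableAt I 𝓘(𝕜, F) g x) :
    mvfderiv I (fun y ↦ L (g y)) x = L ∘L mvfderiv I g x :=
  (L.hasMFDerivAt.comp x hg.hasMFDerivAt).mfderiv

lemma coordDeriv_add_clm_comp {k : M → F'} (L : F' →L[𝕜] F)
    (hg : MDifferentiableAt I 𝓘(𝕜, F) g x) (hk : MDifferentiableAt I 𝓘(𝕜, F') k x) :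
    coordDeriv I G (fun y ↦ g y + L (k y)) x =
      coordDeriv I G g x + L ∘L coordDeriv I G k x := by
  have hLk : MDifferentiableAt I 𝓘(𝕜, F) (fun y ↦ L (k y)) x :=
    L.hasMFDerivAt.mdifferentiableAt.comp x hk
  simp only [coordDeriv, mvfderiv_fun_add hg hLk, mvfderiv_clm_comp L hk,
    ContinuousLinearMap.add_comp, ContinuousLinearMap.comp_assoc]

lemma coordDeriv_congr {g' : M → F} (h : g =ᶠ[𝓝 x] g') :
    coordDeriv I G g x = coordDeriv I G g' x := by
  have hd : mvfderiv I g x = mvfderiv I g' x := h.mfderiv_eq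
  rw [coordDeriv, coordDeriv, hd]

lemma mvfderiv_clm_apply₂ (B : F →L[𝕜] F' →L[𝕜] F'') {k : M → F'}
    (hg : MDifferentiableAt I 𝓘(𝕜, F) g x) (hk : MDifferentiableAt I 𝓘(𝕜, F') k x) :
    mvfderiv I (fun y ↦ B (g y) (k y)) x =
      B (g x) ∘L mvfderiv I k x + B.flip (k x) ∘L mvfderiv I g x := by
  have hgφ := hasFDerivWithinAt_comp_extChartAt_symm_self hg
  have hkφ := hasFDerivWithinAt_comp_extChartAt_symm_self hk
  refine HasMFDerivAt.mfderiv ⟨(B.continuous.continuousAt.comp hg.continuousAt).clm_apply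
    hk.continuousAt, (B.hasFDerivWithinAt_of_bilinear hgφ hkφ).congr_fderiv ?_⟩
  simp only [comp_apply, extChartAt_to_inv]
  rfl

lemma eventually_ne_of_isInvertible_mvfderiv (hg : MDifferentiableAt I 𝓘(𝕜, F) g x)
    (hx : (mvfderiv I g x).IsInvertible) (c : F) : ∀ᶠ y in 𝓝[≠] x, g y ≠ c := by
  have hgφ := hasFDerivWithinAt_comp_extChartAt_symm_self hg
  obtain ⟨N, hN⟩ : ∃ N : E ≃L[𝕜] F, (N : E →L[𝕜] F) = mvfderiv I g x := hx
  rw [← hN] at hgφ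
  have hne := hgφ.eventually_ne (c := c) ⟨_, N.antilipschitz⟩
  have hsource : ∀ᶠ y in 𝓝[≠] x, y ∈ (extChartAt I x).source :=
    mem_nhdsWithin_of_mem_nhds (extChartAt_source_mem_nhds x)
  have hφ : Tendsto (extChartAt I x) (𝓝[≠] x)
      (𝓝[range I \ {extChartAt I x x}] extChartAt I x x) := by
    refine tendsto_nhdsWithin_iff.2 ⟨(continuousAt_extChartAt x).mono_left nhdsWithin_le_nhds, ?_⟩
    filter_upwards [self_mem_nhdsWithin, hsource] with y hyx hy
    exact ⟨extChartAt_target_subset_range x ((extChartAt I x).map_source hy),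
      fun h ↦ hyx ((extChartAt I x).injOn hy (mem_extChartAt_source x) h)⟩
  filter_upwards [hφ.eventually hne, hsource] with y hy hyx
  rwa [comp_apply, (extChartAt I x).left_inv hyx] at hy

variable [IsManifold I 1 M]

variable (I) in
lemma isInvertible_symmL_trivializationAt {q : M} (hx : x ∈ (chartAt H q).source) :
    ((trivializationAt E (TangentSpace I) q).symmL 𝕜 x).IsInvertible :=
  ⟨((trivializationAt E (TangentSpace I) q).continuousLinearEquivAt 𝕜 x hx).symm,
    (trivializationAt E (TangentSpace I) q).symm_continuousLinearEquivAt_eq' hx⟩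

variable (I) in
lemma eventually_isInvertible_symmL (x : M) :
    ∀ᶠ y in 𝓝 x, ((trivializationAt E (TangentSpace I) x).symmL 𝕜 y).IsInvertible :=
  eventually_of_mem (chart_source_mem_nhds H x) fun _ hy ↦ isInvertible_symmL_trivializationAt I hy

variable (I) in
lemma symmL_trivializationAt_self (x : M) :
    (trivializationAt E (TangentSpace I) x).symmL 𝕜 x = .id 𝕜 E := by
  rw [TangentBundle.symmL_trivializationAt_eq_core (mem_chart_source H x)]
  ext v
  exact (tangentBundleCore I M).coordChange_self (achart H x) x (mem_chart_source H x) v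

lemma contMDiffAt_mvfderiv_comp_symmL {m n : ℕ∞ω}
    (hg : ContMDiffAt I 𝓘(𝕜, F) n g x) (hmn : m + 1 ≤ n) :
    ContMDiffAt I 𝓘(𝕜, E →L[𝕜] F) m
      (fun y ↦ mvfderiv I g y ∘L (trivializationAt E (TangentSpace I) x).symmL 𝕜 y) x := by
  refine (hg.mfderiv_const hmn).congr_of_eventuallyEq (.of_forall fun y ↦ ?_)
  simp only [inTangentCoordinates, ContinuousLinearMap.inCoordinates,
    TangentBundle.continuousLinearMapAt_model_space]
  rfl

lemma isInvertible_mvfderiv_comp_symmL_self :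
    (mvfderiv I g x ∘L (trivializationAt E (TangentSpace I) x).symmL 𝕜 x).IsInvertible ↔
      (mvfderiv I g x).IsInvertible := by
  obtain ⟨T, hT⟩ := isInvertible_symmL_trivializationAt I (mem_chart_source H x)
  rw [← hT, ContinuousLinearMap.isInvertible_comp_equiv]

lemma hasFDerivWithinAt_comp_extChartAt_symm {q : M} (hx : x ∈ (chartAt H q).source)
    (hg : MDifferentiableAt I 𝓘(𝕜, F) g x) :
    HasFDerivWithinAt (g ∘ (extChartAt I q).symm)
      (mvfderiv I g x ∘L (trivializationAt E (TangentSpace I) q).symmL 𝕜 x) (range I)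
      (extChartAt I q x) := by
  have hx' : x ∈ (extChartAt I q).source := by rwa [extChartAt_source]
  have hg' : HasMFDerivAt I 𝓘(𝕜, F) g ((extChartAt I q).symm (extChartAt I q x))
      (mfderiv I 𝓘(𝕜, F) g x) := by
    rw [(extChartAt I q).left_inv hx']
    exact hg.hasMFDerivAt
  have hsymm := mdifferentiableWithinAt_extChartAt_symm (I := I) ((extChartAt I q).map_source hx')
  rw [TangentBundle.symmL_trivializationAt hx]
  exact (hg'.comp_hasMFDerivWithinAt _ hsymm.hasMFDerivWithinAt).hasFDerivWithinAt

lemma fderivWithin_comp_extChartAt_symm {q : M} (hx : x ∈ (chartAt H q).source)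
    (hg : MDifferentiableAt I 𝓘(𝕜, F) g x) :
    fderivWithin 𝕜 (g ∘ (extChartAt I q).symm) (range I) (extChartAt I q x) =
      mvfderiv I g x ∘L (trivializationAt E (TangentSpace I) q).symmL 𝕜 x :=
  (hasFDerivWithinAt_comp_extChartAt_symm hx hg).fderivWithin
    (I.uniqueDiffOn _ (mem_range_self _))

lemma fderivWithin_fderivWithin_comp_extChartAt_symm (B : F →L[𝕜] V →L[𝕜] F') {u : M → F'}
    (hu : ∀ᶠ y in 𝓝 x, MDifferentiableAt I 𝓘(𝕜, F') u y)
    (hG : ContMDiffAt I 𝓘(𝕜, V) 2 G x) (hg : MDifferentiableAt I 𝓘(𝕜, F) g x) (hgx : g x = 0)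
    (hd : ∀ᶠ y in 𝓝 x, mvfderiv I u y = B (g y) ∘L mvfderiv I G y) (v w : E) :
    fderivWithin 𝕜 (fderivWithin 𝕜 (u ∘ (extChartAt I x).symm) (range I)) (range I)
      (extChartAt I x x) v w = B (mvfderiv I g x v) (mvfderiv I G x w) := by
  set φ := extChartAt I x
  let Ψ (y : M) : E →L[𝕜] V := mvfderiv I G y ∘L (trivializationAt E (TangentSpace I) x).symmL 𝕜 y
  let C : F →L[𝕜] (E →L[𝕜] V) →L[𝕜] E →L[𝕜] F' := ContinuousLinearMap.compL 𝕜 E V F' ∘L B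
  have hΨ : MDifferentiableAt I 𝓘(𝕜, E →L[𝕜] V) Ψ x :=
    (contMDiffAt_mvfderiv_comp_symmL (m := 1) hG (by norm_num)).mdifferentiableAt one_ne_zero
  have hdu : fderivWithin 𝕜 (u ∘ φ.symm) (range I) =ᶠ[𝓝[range I] φ x]
      fun z ↦ C ((g ∘ φ.symm) z) ((Ψ ∘ φ.symm) z) := by
    have hnear := (hu.and hd).and (chart_source_mem_nhds H x)
    rw [← map_extChartAt_symm_nhdsWithin_range (I := I), eventually_map] at hnear
    filter_upwards [hnear, extChartAt_target_mem_nhdsWithin x] with z ⟨⟨huz, hdz⟩, hz⟩ hzt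
    have hfz := fderivWithin_comp_extChartAt_symm hz huz
    rw [(extChartAt I x).right_inv hzt, hdz] at hfz
    exact hfz
  rw [hdu.fderivWithin_eq (hdu.self_of_nhdsWithin (mem_range_self _)),
    (C.hasFDerivWithinAt_of_bilinear (hasFDerivWithinAt_comp_extChartAt_symm_self hg)
      (hasFDerivWithinAt_comp_extChartAt_symm_self hΨ)).fderivWithin
      (I.uniqueDiffOn _ (mem_range_self _))]
  have hΨx : (Ψ ∘ φ.symm) (φ x) = mvfderiv I G x := by
    rw [comp_apply, extChartAt_to_inv]
    simp only [Ψ, symmL_trivializationAt_self]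
    rfl
  have hgx' : (g ∘ φ.symm) (φ x) = 0 := by rw [comp_apply, extChartAt_to_inv, hgx]
  change C ((g ∘ φ.symm) (φ x)) _ w + C (mvfderiv I g x v) ((Ψ ∘ φ.symm) (φ x)) w = _
  rw [hgx', hΨx, map_zero]
  exact zero_add _

variable [CompleteSpace E]

lemma eventually_isInvertible_mvfderiv (hG : ContMDiffAt I 𝓘(𝕜, V) 1 G x)
    (hx : (mvfderiv I G x).IsInvertible) : ∀ᶠ y in 𝓝 x, (mvfderiv I G y).IsInvertible := by
  have hcont := (contMDiffAt_mvfderiv_comp_symmL (m := 0) hG (by simp)).continuousAt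
  have hmem := hcont.eventually_mem
    (ContinuousLinearEquiv.isOpen.mem_nhds (isInvertible_mvfderiv_comp_symmL_self.2 hx))
  filter_upwards [hmem, eventually_isInvertible_symmL I x] with y hy ⟨T, hT⟩
  rw [← hT] at hy
  exact ContinuousLinearMap.isInvertible_comp_equiv.1 hy

lemma contMDiffAt_coordDeriv {m n : ℕ∞ω} (hG : ContMDiffAt I 𝓘(𝕜, V) n G x)
    (hg : ContMDiffAt I 𝓘(𝕜, F) n g x) (hmn : m + 1 ≤ n) (hx : (mvfderiv I G x).IsInvertible) :
    ContMDiffAt I 𝓘(𝕜, V →L[𝕜] F) m (coordDeriv I G g) x := by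
  have hinv := (isInvertible_mvfderiv_comp_symmL_self.2 hx).contDiffAt_map_inverse
    (n := m).contMDiffAt.comp x (contMDiffAt_mvfderiv_comp_symmL hG hmn)
  refine ((contMDiffAt_mvfderiv_comp_symmL hg hmn).clm_comp hinv).congr_of_eventuallyEq ?_
  filter_upwards [eventually_isInvertible_symmL I x] with y hy
  exact coordDeriv_eq_comp_inverse hy

end CoordinateDerivative

section RealManifold

variable {E : Type*} [NormedAddCommGroup E] [NormedSpace ℝ E]
  {H : Type*} [TopologicalSpace H] {I : ModelWithCorners ℝ E H}
  {M : Type*} [TopologicalSpace M] [ChartedSpace H M]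
  {F : Type*} [NormedAddCommGroup F] [NormedSpace ℝ F]

variable (I) in
lemma dense_interior [IsManifold I 1 M] : Dense (I.interior M) := by
  intro x
  have hx := extChartAt_target_subset_closure_interior (I := I) (mem_extChartAt_target (I := I) x)
  rw [mem_closure_iff_frequently, ← map_extChartAt_symm_nhdsWithin_range (I := I), frequently_map,
    frequently_nhdsWithin_iff]
  refine (mem_closure_iff_frequently.1 hx).mono fun z hz ↦ ?_
  have hzt := interior_subset hz
  refine ⟨(I.isInteriorPoint_iff_of_mem_atlas one_ne_zero (chart_mem_atlas H x) ?_).2 ?_,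
    extChartAt_target_subset_range x hzt⟩
  · rw [← extChartAt_source I]
    exact (extChartAt I x).map_target hzt
  · change extChartAt I x _ ∈ interior (extChartAt I x).target
    rwa [(extChartAt I x).right_inv hzt]

variable [FiniteDimensional ℝ E] [FiniteDimensional ℝ F]

lemma dense_compl_image_of_not_isInvertible_fderivWithin
    (hEF : Module.finrank ℝ E = Module.finrank ℝ F) {f : E → F} {f' : E → E →L[ℝ] F} {s : Set E}
    (hf : ∀ x ∈ s, HasFDerivWithinAt f (f' x) s x) (hcrit : ∀ x ∈ s, ¬ (f' x).IsInvertible) :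
    Dense (f '' s)ᶜ := by
  borelize E
  let N : F ≃L[ℝ] E := .ofFinrankEq hEF.symm
  have hnull : MeasureTheory.Measure.addHaar ((N ∘ f) '' s) = 0 := by
    refine MeasureTheory.addHaar_image_eq_zero_of_det_fderivWithin_eq_zero _
      (fun x hx ↦ N.hasFDerivAt.comp_hasFDerivWithinAt x (hf x hx)) fun x hx ↦ ?_
    by_contra hdet
    have hinv : ((N : F →L[ℝ] E) ∘L f' x).IsInvertible :=
      ⟨_, ContinuousLinearMap.coe_toContinuousLinearEquivOfDetNeZero _ hdet⟩
    exact hcrit x hx (ContinuousLinearMap.isInvertible_equiv_comp.1 hinv)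
  have hdense : Dense (N '' (f '' s))ᶜ := by
    rw [← image_comp]
    exact MeasureTheory.Measure.dense_of_ae (MeasureTheory.measure_eq_zero_iff_ae_notMem.1 hnull)
  convert hdense.preimage N.toHomeomorph.isOpenMap using 1
  ext z
  simp

variable [IsManifold I 1 M]

lemma dense_compl_image_of_not_isInvertible_mvfderiv
    (hEF : Module.finrank ℝ E = Module.finrank ℝ F) {g : M → F} {q : M} {s : Set M}
    (hs : s ⊆ (chartAt H q).source) (hg : ∀ x ∈ s, MDifferentiableAt I 𝓘(ℝ, F) g x)
    (hcrit : ∀ x ∈ s, ¬ (mvfderiv I g x).IsInvertible) : Dense (g '' s)ᶜ := by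
  let φ := extChartAt I q
  have hsφ : s ⊆ φ.source := by rwa [extChartAt_source]
  have hφ : ∀ x ∈ s, φ.symm (φ x) = x := fun x hx ↦ φ.left_inv (hsφ hx)
  have himage : g '' s = (g ∘ φ.symm) '' (φ '' s) := by
    rw [image_image]
    exact image_congr fun x hx ↦ by rw [comp_apply, hφ x hx]
  rw [himage]
  refine dense_compl_image_of_not_isInvertible_fderivWithin hEF (f' := fun z ↦
    mvfderiv I g (φ.symm z) ∘L (trivializationAt E (TangentSpace I) q).symmL ℝ (φ.symm z)) ?_ ?_
  · rintro _ ⟨x, hx, rfl⟩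
    rw [hφ x hx]
    refine (hasFDerivWithinAt_comp_extChartAt_symm (hs hx) (hg x hx)).mono ?_
    rintro _ ⟨y, hy, rfl⟩
    exact extChartAt_target_subset_range q (φ.map_source (hsφ hy))
  · rintro _ ⟨x, hx, rfl⟩ hinv
    rw [hφ x hx] at hinv
    obtain ⟨T, hT⟩ := isInvertible_symmL_trivializationAt I (hs hx)
    rw [← hT] at hinv
    exact hcrit x hx (ContinuousLinearMap.isInvertible_comp_equiv.1 hinv)

end RealManifold

/-! ### Functions holomorphic in the interior -/

namespace ComplexStructure

variable {n : ℕ} [NeZero n] {M : Type*} [TopologicalSpace M]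
  [ChartedSpace (EuclideanHalfSpace (2 * n)) M] (X : ComplexStructure n M)

/-- The functions in `C^k(M) ∩ 𝒪(M^int)`, as an algebra. -/
def holCSubalgebra (k : ℕ∞ω) : Subalgebra ℂ (M → ℂ) where
  carrier := X.holC k
  mul_mem' hf hg := ⟨(contDiff_mul (𝕜 := ℝ) (𝔸 := ℂ)).comp_contMDiff (hf.1.prodMk_space hg.1),
    fun e he ↦ (hf.2 e he).mul (hg.2 e he)⟩
  add_mem' hf hg := ⟨hf.1.add hg.1, fun e he ↦ (hf.2 e he).add (hg.2 e he)⟩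
  algebraMap_mem' c := ⟨contMDiff_const, fun _ _ ↦ differentiableOn_const c⟩

/-- The maps `M → ℂⁿ` whose components belong to `𝒪(M)`. -/
def holMaps : Set (M → Fin n → ℂ) := {G | ∀ j, (fun x ↦ G x j) ∈ X.hol}

variable {X} {k : ℕ∞ω} {f : M → ℂ} {G F : M → Fin n → ℂ}

lemma hol_subset_holC (hk : k ≤ ∞) : X.hol ⊆ X.holC k :=
  fun _ hf ↦ ⟨hf.1.of_le hk, hf.2⟩

lemma exp_mem_holC (hf : f ∈ X.holC k) : (fun x ↦ Complex.exp (f x)) ∈ X.holC k :=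
  ⟨(Complex.contDiff_exp (𝕜 := ℝ)).comp_contMDiff hf.1, fun e he ↦ (hf.2 e he).cexp⟩

lemma sub_const_mem_holC (hf : f ∈ X.holC k) (c : ℂ) : (fun x ↦ f x - c) ∈ X.holC k :=
  (X.holCSubalgebra k).sub_mem hf ((X.holCSubalgebra k).algebraMap_mem c)

lemma dotProduct_mem_hol (hF : F ∈ X.holMaps) (hG : G ∈ X.holMaps) :
    (fun x ↦ F x ⬝ᵥ G x) ∈ X.hol := by
  have h := (X.holCSubalgebra ∞).sum_mem (t := Finset.univ) fun j _ ↦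
    (X.holCSubalgebra ∞).mul_mem (hF j) (hG j)
  rwa [Finset.sum_fn] at h

lemma add_dotProduct_mem_hol (hf : f ∈ X.hol) (hF : F ∈ X.holMaps) (a : Fin n → ℂ) :
    (fun x ↦ f x + a ⬝ᵥ F x) ∈ X.hol :=
  (X.holCSubalgebra ∞).add_mem hf
    (dotProduct_mem_hol (fun j ↦ (X.holCSubalgebra ∞).algebraMap_mem (a j)) hF)

lemma smul_mem_holMaps (hf : f ∈ X.hol) (hF : F ∈ X.holMaps) :
    (fun x ↦ f x • F x) ∈ X.holMaps :=
  fun j ↦ (X.holCSubalgebra ∞).mul_mem hf (hF j)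

lemma contMDiff_of_mem_holMaps (hG : G ∈ X.holMaps) :
    ContMDiff (𝓡∂ (2 * n)) 𝓘(ℝ, Fin n → ℂ) ∞ G :=
  contMDiff_pi_space.2 fun j ↦ (hG j).1

lemma mdifferentiableAt_of_mem_hol (hf : f ∈ X.hol) (x : M) :
    MDifferentiableAt (𝓡∂ (2 * n)) 𝓘(ℝ, ℂ) f x :=
  (hf.1 x).mdifferentiableAt (by simp)

lemma mdifferentiableAt_of_mem_holMaps (hG : G ∈ X.holMaps) (x : M) :
    MDifferentiableAt (𝓡∂ (2 * n)) 𝓘(ℝ, Fin n → ℂ) G x :=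
  (contMDiff_of_mem_holMaps hG x).mdifferentiableAt (by simp)

end ComplexStructure

section HolomorphicDifferential

variable {n : ℕ} [NeZero n] {M : Type*} [TopologicalSpace M]
  [ChartedSpace (EuclideanHalfSpace (2 * n)) M]

lemma IsSmoothChart.contMDiffAt {e : PartialEquiv M (Fin n → ℂ)} (he : IsSmoothChart e)
    {x : M} (hx : x ∈ e.source) : ContMDiffAt (𝓡∂ (2 * n)) 𝓘(ℝ, Fin n → ℂ) ∞ e x :=
  he.contMDiffOn_toFun.contMDiffAt (he.isOpen_source.mem_nhds hx)

lemma IsSmoothChart.mdifferentiableAt {e : PartialEquiv M (Fin n → ℂ)} (he : IsSmoothChart e)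
    {x : M} (hx : x ∈ e.source) : MDifferentiableAt (𝓡∂ (2 * n)) 𝓘(ℝ, Fin n → ℂ) e x :=
  (he.contMDiffAt hx).mdifferentiableAt (by simp)

lemma IsSmoothChart.isInvertible_mvfderiv {e : PartialEquiv M (Fin n → ℂ)} (he : IsSmoothChart e)
    {x : M} (hx : x ∈ e.source) : (mvfderiv (𝓡∂ (2 * n)) e x).IsInvertible := by
  have hsymm := ((he.contMDiffOn_symm _ (e.map_source hx)).mdifferentiableWithinAt
    (by simp)).hasMFDerivWithinAt
  have hcomp := hsymm.comp x (he.mdifferentiableAt hx).hasMFDerivAt.hasMFDerivWithinAt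
    fun y hy ↦ e.map_source hy
  have hid := (hasMFDerivWithinAt_id (I := 𝓡∂ (2 * n)) e.source x).congr_of_eventuallyEq
    (f₁ := e.symm ∘ e) (eventually_nhdsWithin_of_forall fun y hy ↦ e.left_inv hy) (e.left_inv hx)
  have hinv := (he.isOpen_source.uniqueMDiffWithinAt hx).eq hcomp hid
  have hleft : LeftInverse (mfderivWithin 𝓘(ℝ, Fin n → ℂ) (𝓡∂ (2 * n)) e.symm e.target (e x))
      (mvfderiv (𝓡∂ (2 * n)) e x) := fun v ↦ congrArg (fun L ↦ L v) hinv
  exact isInvertible_of_injective (E := EuclideanSpace ℝ (Fin (2 * n)))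
    (finrank_euclideanSpace_eq n) hleft.injective

lemma ComplexStructure.HasGlobalHolomorphicCharts.exists_coordinates {X : ComplexStructure n M}
    (hcharts : X.HasGlobalHolomorphicCharts) (q : M) :
    ∃ G ∈ X.holMaps, G q = 0 ∧ (mvfderiv (𝓡∂ (2 * n)) G q).IsInvertible := by
  obtain ⟨f, hf, e, ⟨he, -⟩, hq, hfe⟩ := hcharts q
  refine ⟨fun x j ↦ f j x - f j q, fun j ↦ sub_const_mem_holC (hf j) _,
    funext fun j ↦ sub_self _, ?_⟩
  have hGe : (fun x j ↦ f j x - f j q) =ᶠ[𝓝 q] fun x ↦ e x - e q := by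
    filter_upwards [he.isOpen_source.mem_nhds hq] with x hx
    ext j
    rw [Pi.sub_apply, hfe x hx, hfe q hq]
  have hd : mvfderiv (𝓡∂ (2 * n)) (fun x j ↦ f j x - f j q) q =
      mvfderiv (𝓡∂ (2 * n)) (fun x ↦ e x - e q) q := hGe.mfderiv_eq
  rw [hd, mvfderiv_fun_sub (he.mdifferentiableAt hq) mdifferentiableAt_const, mvfderiv_const,
    sub_zero]
  exact he.isInvertible_mvfderiv hq

variable [IsManifold (𝓡∂ (2 * n)) ∞ M]

lemma IsSmoothChart.exists_mvfderiv_eq_restrictScalars_comp {F : Type*} [NormedAddCommGroup F]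
    [NormedSpace ℂ F] {e : PartialEquiv M (Fin n → ℂ)} (he : IsSmoothChart e) {x : M}
    (hx : x ∈ e.source ∩ (𝓡∂ (2 * n)).interior M) {u : M → F}
    (hu : DifferentiableWithinAt ℂ (u ∘ e.symm)
      (e '' (e.source ∩ (𝓡∂ (2 * n)).interior M)) (e x)) :
    ∃ L : (Fin n → ℂ) →L[ℂ] F,
      mvfderiv (𝓡∂ (2 * n)) u x = L.restrictScalars ℝ ∘L mvfderiv (𝓡∂ (2 * n)) e x := by
  obtain ⟨L, hL⟩ := hu
  have hopen : IsOpen (e.source ∩ (𝓡∂ (2 * n)).interior M) :=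
    he.isOpen_source.inter ((𝓡∂ (2 * n)).isOpen_interior (n := ∞) (by simp))
  have hcomp := (hL.restrictScalars ℝ).hasMFDerivWithinAt.comp x
    (he.mdifferentiableAt hx.1).hasMFDerivAt.hasMFDerivWithinAt (subset_preimage_image e _)
  have hue : u =ᶠ[𝓝 x] (u ∘ e.symm) ∘ e := by
    filter_upwards [hopen.mem_nhds hx] with y hy
    rw [comp_apply, comp_apply, e.left_inv hy.1]
  exact ⟨L, ((hcomp.hasMFDerivAt (hopen.mem_nhds hx)).congr_of_eventuallyEq hue).mfderiv⟩

namespace ComplexStructure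

variable {X : ComplexStructure n M} {f : M → ℂ} {G : M → Fin n → ℂ} {x : M}

lemma coordDeriv_smul_of_mem_interior (hf : f ∈ X.hol) (hG : G ∈ X.holMaps)
    (hx : (mvfderiv (𝓡∂ (2 * n)) G x).IsInvertible) (hxint : x ∈ (𝓡∂ (2 * n)).interior M)
    (c : ℂ) (w : Fin n → ℂ) :
    coordDeriv (𝓡∂ (2 * n)) G f x (c • w) = c • coordDeriv (𝓡∂ (2 * n)) G f x w := by
  obtain ⟨e, heX, hxe⟩ := X.cover x
  have he := X.isSmoothChart e heX
  have hex := mem_image_of_mem e (mem_inter hxe hxint)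
  obtain ⟨A, hA⟩ := he.exists_mvfderiv_eq_restrictScalars_comp ⟨hxe, hxint⟩ (hf.2 e heX _ hex)
  obtain ⟨B, hB⟩ := he.exists_mvfderiv_eq_restrictScalars_comp (u := G) ⟨hxe, hxint⟩
    (differentiableWithinAt_pi.2 fun j ↦ (hG j).2 e heX _ hex)
  obtain ⟨v, rfl⟩ := hx.surjective w
  obtain ⟨v', hv'⟩ := (he.isInvertible_mvfderiv hxe).surjective
    (c • mvfderiv (𝓡∂ (2 * n)) e x v)
  have hGv : c • mvfderiv (𝓡∂ (2 * n)) G x v = mvfderiv (𝓡∂ (2 * n)) G x v' := by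
    simp [hB, hv']
  rw [hGv, coordDeriv_mvfderiv_apply hx, coordDeriv_mvfderiv_apply hx]
  simp [hA, hv']

lemma coordDeriv_smul (hf : f ∈ X.hol) (hG : G ∈ X.holMaps)
    (hx : (mvfderiv (𝓡∂ (2 * n)) G x).IsInvertible) (c : ℂ) (w : Fin n → ℂ) :
    coordDeriv (𝓡∂ (2 * n)) G f x (c • w) = c • coordDeriv (𝓡∂ (2 * n)) G f x w := by
  have : (𝓝[(𝓡∂ (2 * n)).interior M] x).NeBot :=
    mem_closure_iff_nhdsWithin_neBot.1 (dense_interior (𝓡∂ (2 * n)) x)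
  have hcont : ContinuousAt (coordDeriv (𝓡∂ (2 * n)) G f) x :=
    (contMDiffAt_coordDeriv (contMDiff_of_mem_holMaps hG x) (hf.1 x) (m := 0) (by simp)
      hx).continuousAt
  have htend (w) : Tendsto (fun y ↦ coordDeriv (𝓡∂ (2 * n)) G f y w)
      (𝓝[(𝓡∂ (2 * n)).interior M] x) (𝓝 (coordDeriv (𝓡∂ (2 * n)) G f x w)) :=
    (hcont.clm_apply continuousAt_const).mono_left nhdsWithin_le_nhds
  have hinv := eventually_isInvertible_mvfderiv
    ((contMDiff_of_mem_holMaps hG x).of_le (by simp)) hx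
  refine tendsto_nhds_unique_of_eventuallyEq (htend (c • w)) ((htend w).const_smul c) ?_
  filter_upwards [self_mem_nhdsWithin, mem_nhdsWithin_of_mem_nhds hinv] with y hyint hy
  exact coordDeriv_smul_of_mem_interior hf hG hy hyint c w

end ComplexStructure

end HolomorphicDifferential

/-! ### Gradients and nondegenerate critical points -/

open ComplexStructure

section Gradient

/-- The bilinear form `(a, w) ↦ ∑ⱼ aⱼ wⱼ` on `ℂⁿ`, as a continuous real bilinear map. -/
def dotProductCLM (n : ℕ) : (Fin n → ℂ) →L[ℝ] (Fin n → ℂ) →L[ℝ] ℂ :=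
  (dotProductBilin ℝ ℝ).toContinuousBilinearMap

/-- The coefficients of a functional on `ℂⁿ`: its values on the standard basis. It inverts
`dotProductCLM` on complex linear functionals. -/
def coeffCLM (n : ℕ) : ((Fin n → ℂ) →L[ℝ] ℂ) →L[ℝ] Fin n → ℂ :=
  .pi fun j ↦ .apply ℝ ℂ (Pi.single j 1)

lemma coeffCLM_dotProductCLM {n : ℕ} (a : Fin n → ℂ) : coeffCLM n (dotProductCLM n a) = a :=
  funext fun j ↦ dotProduct_single_one a j

lemma coeffCLM_dotProduct {n : ℕ} {L : (Fin n → ℂ) →L[ℝ] ℂ} (hL : ∀ (c : ℂ) w, L (c • w) = c • L w)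
    (w : Fin n → ℂ) : coeffCLM n L ⬝ᵥ w = L w := by
  conv_rhs => rw [pi_eq_sum_univ' w, map_sum]
  refine Finset.sum_congr rfl fun j _ ↦ ?_
  rw [hL, smul_eq_mul, mul_comm]
  rfl

/-- The map `(a, T) ↦ aᵀ T`, for real linear endomorphisms `T` of `ℂⁿ`: the coefficients of the
functional `w ↦ a ⬝ᵥ T w`. -/
def vecMulCLM (n : ℕ) :
    (Fin n → ℂ) →L[ℝ] ((Fin n → ℂ) →L[ℝ] Fin n → ℂ) →L[ℝ] Fin n → ℂ :=
  .compL ℝ _ _ _ (coeffCLM n) ∘L .compL ℝ _ _ _ ∘L dotProductCLM n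

lemma vecMulCLM_id {n : ℕ} (a : Fin n → ℂ) : vecMulCLM n a (.id ℝ _) = a :=
  coeffCLM_dotProductCLM a

lemma eq_zero_of_forall_im_dotProduct {n : ℕ} {a : Fin n → ℂ} (ha : ∀ w, (a ⬝ᵥ w).im = 0) :
    a = 0 := by
  ext j
  apply Complex.ext
  · simpa using ha (Pi.single j Complex.I)
  · simpa using ha (Pi.single j 1)

variable {n : ℕ} [NeZero n] {M : Type*} [TopologicalSpace M]
  [ChartedSpace (EuclideanHalfSpace (2 * n)) M]

/-- The gradient of `f` in the coordinates `G : M → ℂⁿ`: its entries are the derivatives of `f`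
along the standard basis of `ℂⁿ`, which are the `∂f/∂Gⱼ` when `f` and `G` are holomorphic. -/
def grad (G : M → Fin n → ℂ) (f : M → ℂ) (x : M) : Fin n → ℂ :=
  coeffCLM n (coordDeriv (𝓡∂ (2 * n)) G f x)

variable {f : M → ℂ} {F G : M → Fin n → ℂ} {x : M}

lemma grad_add_dotProduct (hf : MDifferentiableAt (𝓡∂ (2 * n)) 𝓘(ℝ, ℂ) f x)
    (hF : MDifferentiableAt (𝓡∂ (2 * n)) 𝓘(ℝ, Fin n → ℂ) F x) (a : Fin n → ℂ) :
    grad G (fun y ↦ f y + a ⬝ᵥ F y) x =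
      grad G f x + vecMulCLM n a (coordDeriv (𝓡∂ (2 * n)) G F x) :=
  (congrArg (coeffCLM n) (coordDeriv_add_clm_comp (dotProductCLM n a) hf hF)).trans
    (map_add (coeffCLM n) _ _)

lemma grad_add_dotProduct_self (hG : MDifferentiableAt (𝓡∂ (2 * n)) 𝓘(ℝ, Fin n → ℂ) G x)
    (hx : (mvfderiv (𝓡∂ (2 * n)) G x).IsInvertible)
    (hf : MDifferentiableAt (𝓡∂ (2 * n)) 𝓘(ℝ, ℂ) f x) (a : Fin n → ℂ) :
    grad G (fun y ↦ f y + a ⬝ᵥ G y) x = grad G f x + a := by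
  rw [grad_add_dotProduct hf hG, coordDeriv_self hx, vecMulCLM_id]

variable [IsManifold (𝓡∂ (2 * n)) ∞ M] {X : ComplexStructure n M}

lemma contMDiffAt_grad (hG : G ∈ X.holMaps) (hx : (mvfderiv (𝓡∂ (2 * n)) G x).IsInvertible)
    (hf : f ∈ X.hol) : ContMDiffAt (𝓡∂ (2 * n)) 𝓘(ℝ, Fin n → ℂ) ∞ (grad G f) x :=
  (coeffCLM n).contMDiff.contMDiffAt.comp x <| contMDiffAt_coordDeriv
    (contMDiff_of_mem_holMaps hG x) (hf.1 x) (by simp) hx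

lemma mvfderiv_eq_grad_comp (hG : G ∈ X.holMaps)
    (hx : (mvfderiv (𝓡∂ (2 * n)) G x).IsInvertible) (hf : f ∈ X.hol) :
    mvfderiv (𝓡∂ (2 * n)) f x = dotProductCLM n (grad G f x) ∘L mvfderiv (𝓡∂ (2 * n)) G x := by
  rw [← coordDeriv_comp_mvfderiv hx]
  congr 1
  ext1 w
  exact (coeffCLM_dotProduct (coordDeriv_smul hf hG hx) w).symm

end Gradient

section Morse

variable {n : ℕ} [NeZero n] {M : Type*} [TopologicalSpace M]
  [ChartedSpace (EuclideanHalfSpace (2 * n)) M]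

/-- `x` is not a degenerate critical point of `u`. -/
def IsMorseAt (u : M → ℝ) (x : M) : Prop :=
  IsCriticalPoint (n := n) u x →
    ∀ v : EuclideanSpace ℝ (Fin (2 * n)), (∀ w, hessianAt (n := n) u x v w = 0) → v = 0

variable [IsManifold (𝓡∂ (2 * n)) ∞ M] {X : ComplexStructure n M} {f : M → ℂ}
  {G : M → Fin n → ℂ} {x : M}

lemma mvfderiv_im_eq_grad_comp (hG : G ∈ X.holMaps)
    (hx : (mvfderiv (𝓡∂ (2 * n)) G x).IsInvertible) (hf : f ∈ X.hol) :
    mvfderiv (𝓡∂ (2 * n)) (fun y ↦ (f y).im) x =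
      (Complex.imCLM ∘L dotProductCLM n (grad G f x)) ∘L mvfderiv (𝓡∂ (2 * n)) G x := by
  rw [ContinuousLinearMap.comp_assoc, ← mvfderiv_eq_grad_comp hG hx hf]
  exact mvfderiv_clm_comp Complex.imCLM (mdifferentiableAt_of_mem_hol hf x)

lemma isCriticalPoint_im_iff (hG : G ∈ X.holMaps)
    (hx : (mvfderiv (𝓡∂ (2 * n)) G x).IsInvertible) (hf : f ∈ X.hol) :
    IsCriticalPoint (n := n) (fun y ↦ (f y).im) x ↔ grad G f x = 0 := by
  have hd := mvfderiv_im_eq_grad_comp hG hx hf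
  refine ⟨fun h ↦ eq_zero_of_forall_im_dotProduct fun w ↦ ?_, fun h ↦ ?_⟩
  · obtain ⟨v, rfl⟩ := hx.surjective w
    exact (DFunLike.congr_fun hd v).symm.trans (DFunLike.congr_fun h v)
  · rw [h, map_zero, ContinuousLinearMap.comp_zero, ContinuousLinearMap.zero_comp] at hd
    exact hd

lemma hessianAt_im (hG : G ∈ X.holMaps) (hx : (mvfderiv (𝓡∂ (2 * n)) G x).IsInvertible)
    (hf : f ∈ X.hol) (hcrit : grad G f x = 0) (v w : EuclideanSpace ℝ (Fin (2 * n))) :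
    hessianAt (n := n) (fun y ↦ (f y).im) x v w =
      (mvfderiv (𝓡∂ (2 * n)) (grad G f) x v ⬝ᵥ mvfderiv (𝓡∂ (2 * n)) G x w).im := by
  have hGx := contMDiff_of_mem_holMaps hG x
  refine fderivWithin_fderivWithin_comp_extChartAt_symm
    (ContinuousLinearMap.compL ℝ (Fin n → ℂ) ℂ ℝ Complex.imCLM ∘L dotProductCLM n)
    (.of_forall fun y ↦ ?_) (hGx.of_le ENat.LEInfty.out)
    ((contMDiffAt_grad hG hx hf).mdifferentiableAt (by simp)) hcrit ?_ v w
  · exact Complex.imCLM.hasMFDerivAt.mdifferentiableAt.comp y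
      (mdifferentiableAt_of_mem_hol hf y)
  · filter_upwards [eventually_isInvertible_mvfderiv (hGx.of_le (by simp)) hx] with y hy
    exact mvfderiv_im_eq_grad_comp hG hy hf

lemma isMorseAt_im_iff (hG : G ∈ X.holMaps)
    (hx : (mvfderiv (𝓡∂ (2 * n)) G x).IsInvertible) (hf : f ∈ X.hol) :
    IsMorseAt (n := n) (fun y ↦ (f y).im) x ↔
      (grad G f x = 0 → (mvfderiv (𝓡∂ (2 * n)) (grad G f) x).IsInvertible) := by
  rw [IsMorseAt, isCriticalPoint_im_iff hG hx hf]
  refine imp_congr_right fun hcrit ↦ ?_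
  simp only [hessianAt_im hG hx hf hcrit]
  refine ⟨fun h ↦ isInvertible_of_injective (E := EuclideanSpace ℝ (Fin (2 * n)))
    (finrank_euclideanSpace_eq n) ((injective_iff_map_eq_zero _).2 fun v hv ↦ h v fun w ↦ ?_),
    fun h v hv ↦ h.injective ?_⟩
  · rw [show mvfderiv (𝓡∂ (2 * n)) (grad G f) x v = 0 from hv, zero_dotProduct, Complex.zero_im]
  · refine Eq.trans (eq_zero_of_forall_im_dotProduct fun w ↦ ?_) (map_zero _).symm
    obtain ⟨w, rfl⟩ := hx.surjective w
    exact hv w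

end Morse

section Perturbation

variable {n : ℕ} [NeZero n] {M : Type*} [TopologicalSpace M]
  [ChartedSpace (EuclideanHalfSpace (2 * n)) M] [IsManifold (𝓡∂ (2 * n)) ∞ M]
  {X : ComplexStructure n M} {f : M → ℂ} {F G : M → Fin n → ℂ} {x : M}

lemma coordDeriv_grad_add_dotProduct (hG : G ∈ X.holMaps)
    (hx : (mvfderiv (𝓡∂ (2 * n)) G x).IsInvertible) (hf : f ∈ X.hol) (hF : F ∈ X.holMaps)
    (a : Fin n → ℂ) :
    coordDeriv (𝓡∂ (2 * n)) G (grad G fun y ↦ f y + a ⬝ᵥ F y) x =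
      coordDeriv (𝓡∂ (2 * n)) G (grad G f) x +
        vecMulCLM n a ∘L coordDeriv (𝓡∂ (2 * n)) G (coordDeriv (𝓡∂ (2 * n)) G F) x := by
  have hdF := contMDiffAt_coordDeriv (contMDiff_of_mem_holMaps hG x)
    (contMDiff_of_mem_holMaps hF x) (m := ∞) (by simp) hx
  rw [← coordDeriv_add_clm_comp (vecMulCLM n a)
    ((contMDiffAt_grad hG hx hf).mdifferentiableAt (by simp)) (hdF.mdifferentiableAt (by simp))]
  exact coordDeriv_congr (.of_forall fun y ↦ grad_add_dotProduct
    (mdifferentiableAt_of_mem_hol hf y) (mdifferentiableAt_of_mem_holMaps hF y) a)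

lemma eventually_isMorseAt_im_add_dotProduct (hG : G ∈ X.holMaps)
    (hx : (mvfderiv (𝓡∂ (2 * n)) G x).IsInvertible) (hf : f ∈ X.hol) (hF : F ∈ X.holMaps)
    (hmorse : IsMorseAt (n := n) (fun y ↦ (f y).im) x) :
    ∀ᶠ z : (Fin n → ℂ) × M in 𝓝 (0, x),
      IsMorseAt (n := n) (fun y ↦ (f y + z.1 ⬝ᵥ F y).im) z.2 := by
  have hGx := contMDiff_of_mem_holMaps hG x
  have hgrad := contMDiffAt_grad hG hx hf
  have hdF := contMDiffAt_coordDeriv hGx (contMDiff_of_mem_holMaps hF x) (m := ∞) (by simp) hx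
  have hdgrad := contMDiffAt_coordDeriv hGx hgrad (m := ∞) (by simp) hx
  have hddF := contMDiffAt_coordDeriv hGx hdF (m := ∞) (by simp) hx
  let b (z : (Fin n → ℂ) × M) : Fin n → ℂ :=
    grad G f z.2 + vecMulCLM n z.1 (coordDeriv (𝓡∂ (2 * n)) G F z.2)
  let L (z : (Fin n → ℂ) × M) : (Fin n → ℂ) →L[ℝ] Fin n → ℂ :=
    coordDeriv (𝓡∂ (2 * n)) G (grad G f) z.2 +
      vecMulCLM n z.1 ∘L coordDeriv (𝓡∂ (2 * n)) G (coordDeriv (𝓡∂ (2 * n)) G F) z.2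
  have ha : ContinuousAt (fun z : (Fin n → ℂ) × M ↦ vecMulCLM n z.1) (0, x) := by fun_prop
  have hb : ContinuousAt b (0, x) :=
    hgrad.continuousAt.snd''.add (ha.clm_apply hdF.continuousAt.snd'')
  have hL : ContinuousAt L (0, x) :=
    hdgrad.continuousAt.snd''.add (ha.clm_comp hddF.continuousAt.snd'')
  have hbL : ∀ᶠ z in 𝓝 (0, x), b z = 0 → (L z).IsInvertible := by
    rcases eq_or_ne (grad G f x) 0 with hcrit | hcrit
    · have hinv : (L (0, x)).IsInvertible := by
        simpa [L, isInvertible_coordDeriv_iff hx] using (isMorseAt_im_iff hG hx hf).1 hmorse hcrit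
      exact (hL.eventually_mem (ContinuousLinearEquiv.isOpen.mem_nhds hinv)).mono fun _ h _ ↦ h
    · exact (hb.eventually_ne (by simpa [b] using hcrit)).mono fun _ h h' ↦ absurd h' h
  have hinv := (eventually_isInvertible_mvfderiv (hGx.of_le (by simp)) hx).prod_inr_nhds
    (0 : Fin n → ℂ)
  filter_upwards [hbL, hinv] with z hz hGz
  rwa [isMorseAt_im_iff hG hGz (add_dotProduct_mem_hol hf hF z.1),
    ← isInvertible_coordDeriv_iff hGz, coordDeriv_grad_add_dotProduct hG hGz hf hF,
    grad_add_dotProduct (mdifferentiableAt_of_mem_hol hf _)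
      (mdifferentiableAt_of_mem_holMaps hF _)]

lemma eventually_forall_isMorseAt_im_add_dotProduct (hcharts : X.HasGlobalHolomorphicCharts)
    (hf : f ∈ X.hol) (hF : F ∈ X.holMaps) {K : Set M} (hK : IsCompact K)
    (hmorse : ∀ x ∈ K, IsMorseAt (n := n) (fun y ↦ (f y).im) x) :
    ∀ᶠ a : Fin n → ℂ in 𝓝 0, ∀ x ∈ K, IsMorseAt (n := n) (fun y ↦ (f y + a ⬝ᵥ F y).im) x :=
  hK.eventually_forall_of_forall_eventually fun x hx ↦
    have ⟨_, hG, _, hGx⟩ := hcharts.exists_coordinates x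
    eventually_isMorseAt_im_add_dotProduct hG hGx hf hF (hmorse x hx)

lemma mvfderiv_grad_add_dotProduct_self (hG : G ∈ X.holMaps)
    (hx : (mvfderiv (𝓡∂ (2 * n)) G x).IsInvertible) (hf : f ∈ X.hol) (a : Fin n → ℂ) :
    mvfderiv (𝓡∂ (2 * n)) (grad G fun y ↦ f y + a ⬝ᵥ G y) x =
      mvfderiv (𝓡∂ (2 * n)) (grad G f) x := by
  have hnear : (grad G fun y ↦ f y + a ⬝ᵥ G y) =ᶠ[𝓝 x] fun y ↦ grad G f y + a := by
    filter_upwards [eventually_isInvertible_mvfderiv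
      ((contMDiff_of_mem_holMaps hG x).of_le (by simp)) hx] with y hy
    exact grad_add_dotProduct_self (mdifferentiableAt_of_mem_holMaps hG y) hy
      (mdifferentiableAt_of_mem_hol hf y) a
  have hd : mvfderiv (𝓡∂ (2 * n)) (grad G fun y ↦ f y + a ⬝ᵥ G y) x =
    mvfderiv (𝓡∂ (2 * n)) (fun y ↦ grad G f y + a) x := hnear.mfderiv_eq
  rw [hd, mvfderiv_fun_add ((contMDiffAt_grad hG hx hf).mdifferentiableAt (by simp))
    mdifferentiableAt_const, mvfderiv_const, add_zero]

lemma dense_setOf_forall_isMorseAt_im_add_dotProduct (hG : G ∈ X.holMaps) (hf : f ∈ X.hol)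
    {q : M} {s : Set M} (hs : s ⊆ (chartAt (EuclideanHalfSpace (2 * n)) q).source)
    (hinv : ∀ x ∈ s, (mvfderiv (𝓡∂ (2 * n)) G x).IsInvertible) :
    Dense {a : Fin n → ℂ | ∀ x ∈ s, IsMorseAt (n := n) (fun y ↦ (f y + a ⬝ᵥ G y).im) x} := by
  let t := {x ∈ s | ¬ (mvfderiv (𝓡∂ (2 * n)) (grad G f) x).IsInvertible}
  have hsard : Dense (grad G f '' t)ᶜ :=
    dense_compl_image_of_not_isInvertible_mvfderiv (I := 𝓡∂ (2 * n))
      (finrank_euclideanSpace_eq n) ((sep_subset _ _).trans hs)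
      (fun x hx ↦ (contMDiffAt_grad hG (hinv x hx.1) hf).mdifferentiableAt (by simp))
      fun x hx ↦ hx.2
  refine (hsard.preimage (Homeomorph.neg (Fin n → ℂ)).isOpenMap).mono fun a ha x hx ↦ ?_
  rw [isMorseAt_im_iff hG (hinv x hx) (add_dotProduct_mem_hol hf hG a),
    mvfderiv_grad_add_dotProduct_self hG (hinv x hx) hf,
    grad_add_dotProduct_self (mdifferentiableAt_of_mem_holMaps hG x) (hinv x hx)
      (mdifferentiableAt_of_mem_hol hf x)]
  intro hcrit
  by_contra hdeg
  exact ha ⟨x, ⟨hx, hdeg⟩, eq_neg_of_add_eq_zero_left hcrit⟩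

end Perturbation

/-! ### Existence of the phase and the amplitude -/

section Existence

variable {n : ℕ} [NeZero n] {M : Type*} [TopologicalSpace M]
  [ChartedSpace (EuclideanHalfSpace (2 * n)) M]
  {X : ComplexStructure n M} {f h : M → ℂ} {F G : M → Fin n → ℂ} {p q x : M}

lemma exists_mem_hol_eq_one_eq_zero (hsep : X.HolomorphicallySeparable) (p : M) {s : Set M}
    (hs : s.Finite) : ∃ a ∈ X.hol, a p = 1 ∧ ∀ q ∈ s, q ≠ p → a q = 0 := by
  have hpair (q : M) : ∃ a ∈ X.hol, a p = 1 ∧ (q ≠ p → a q = 0) := by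
    rcases eq_or_ne q p with rfl | hqp
    · exact ⟨1, (X.holCSubalgebra ∞).one_mem, rfl, fun h ↦ absurd rfl h⟩
    · obtain ⟨f, hf, hne⟩ := hsep q p hqp
      exact ⟨(f p - f q)⁻¹ • fun x ↦ f x - f q,
        (X.holCSubalgebra ∞).smul_mem (sub_const_mem_holC hf _) _,
        inv_mul_cancel₀ (sub_ne_zero.2 hne.symm), fun _ ↦ by simp⟩
  choose a ha hap haq using hpair
  refine ⟨∏ q ∈ hs.toFinset, a q, (X.holCSubalgebra ∞).prod_mem fun q _ ↦ ha q, ?_,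
    fun q hq hqp ↦ ?_⟩
  · rw [Finset.prod_apply]
    exact Finset.prod_eq_one fun q _ ↦ hap q
  · rw [Finset.prod_apply]
    exact Finset.prod_eq_zero (hs.mem_toFinset.2 hq) (haq q hqp)

lemma mvfderiv_smul_of_eq_zero (hh : h ∈ X.hol) (hF : F ∈ X.holMaps) (hx : F x = 0) :
    mvfderiv (𝓡∂ (2 * n)) (fun y ↦ h y • F y) x = h x • mvfderiv (𝓡∂ (2 * n)) F x := by
  have hd := mvfderiv_clm_apply₂ (ContinuousLinearMap.lsmul ℝ ℂ)
    (mdifferentiableAt_of_mem_hol hh x) (mdifferentiableAt_of_mem_holMaps hF x)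
  rw [hx, map_zero, ContinuousLinearMap.zero_comp, add_zero] at hd
  exact hd

lemma exists_coordinates_of_ne (hcharts : X.HasGlobalHolomorphicCharts)
    (hsep : X.HolomorphicallySeparable) (hpq : q ≠ p) :
    ∃ F ∈ X.holMaps, mvfderiv (𝓡∂ (2 * n)) F p = 0 ∧
      (mvfderiv (𝓡∂ (2 * n)) F q).IsInvertible := by
  obtain ⟨G, hG, hGq, hinv⟩ := hcharts.exists_coordinates q
  obtain ⟨f, hf, hne⟩ := hsep q p hpq
  let h (x : M) : ℂ := f x - f p
  have hh : h ∈ X.hol := sub_const_mem_holC hf _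
  have hhq : h q ≠ 0 := sub_ne_zero.2 hne
  have hhp : h p = 0 := sub_self _
  have hhG := smul_mem_holMaps hh hG
  refine ⟨fun x ↦ h x • h x • G x, smul_mem_holMaps hh hhG, ?_, ?_⟩
  · rw [mvfderiv_smul_of_eq_zero hh hhG (by rw [hhp, zero_smul]), hhp, zero_smul]
  · rw [mvfderiv_smul_of_eq_zero hh hhG (by rw [hGq, smul_zero]),
      mvfderiv_smul_of_eq_zero hh hG hGq]
    have hsmul : Injective fun w : Fin n → ℂ ↦ h q • w := smul_right_injective _ hhq
    exact isInvertible_of_injective (E := EuclideanSpace ℝ (Fin (2 * n)))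
      (finrank_euclideanSpace_eq n) (hsmul.comp (hsmul.comp hinv.injective))

lemma mvfderiv_half_dotProduct_self (hG : G ∈ X.holMaps) (x : M) :
    mvfderiv (𝓡∂ (2 * n)) (fun y ↦ 2⁻¹ * (G y ⬝ᵥ G y)) x =
      dotProductCLM n (G x) ∘L mvfderiv (𝓡∂ (2 * n)) G x := by
  have hGx := mdifferentiableAt_of_mem_holMaps hG x
  have hhalf : (fun y ↦ 2⁻¹ * (G y ⬝ᵥ G y)) =
      fun y ↦ ((2⁻¹ : ℝ) • dotProductCLM n) (G y) (G y) := by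
    ext y
    have hreal := Complex.real_smul (x := 2⁻¹) (z := G y ⬝ᵥ G y)
    rw [Complex.ofReal_inv, Complex.ofReal_ofNat] at hreal
    exact hreal.symm
  have hflip : (dotProductCLM n).flip = dotProductCLM n := by
    ext a b
    exact dotProduct_comm b a
  have hadd : (2⁻¹ : ℝ) • dotProductCLM n + (2⁻¹ : ℝ) • dotProductCLM n = dotProductCLM n := by
    module
  rw [hhalf, mvfderiv_clm_apply₂ _ hGx hGx, ContinuousLinearMap.flip_smul, hflip,
    ← ContinuousLinearMap.add_comp, ← add_apply, hadd]

/-- The functions in `𝒪(M)` that are critical at `p` and whose imaginary part has only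
nondegenerate critical points in `K`: the candidates for the phase `Φ`, with `K` exhausting `M`. -/
def ComplexStructure.morseCandidates (X : ComplexStructure n M) (p : M) (K : Set M) :
    Set (M → ℂ) :=
  {f ∈ X.hol | mvfderiv (𝓡∂ (2 * n)) f p = 0 ∧ ∀ x ∈ K, IsMorseAt (n := n) (fun y ↦ (f y).im) x}

variable [IsManifold (𝓡∂ (2 * n)) ∞ M]

lemma isMorseAt_im_half_dotProduct_self (hG : G ∈ X.holMaps)
    (hx : (mvfderiv (𝓡∂ (2 * n)) G x).IsInvertible) :
    IsMorseAt (n := n) (fun y ↦ (2⁻¹ * (G y ⬝ᵥ G y)).im) x := by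
  have hf : (fun y ↦ 2⁻¹ * (G y ⬝ᵥ G y)) ∈ X.hol :=
    (X.holCSubalgebra ∞).smul_mem (dotProduct_mem_hol hG hG) (2⁻¹ : ℂ)
  have hgrad : (grad G fun y ↦ 2⁻¹ * (G y ⬝ᵥ G y)) =ᶠ[𝓝 x] G := by
    filter_upwards [eventually_isInvertible_mvfderiv
      ((contMDiff_of_mem_holMaps hG x).of_le (by simp)) hx] with y hy
    rw [grad, coordDeriv, mvfderiv_half_dotProduct_self hG, ContinuousLinearMap.comp_assoc,
      hy.self_comp_inverse, ContinuousLinearMap.comp_id, coeffCLM_dotProductCLM]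
  have hd : mvfderiv (𝓡∂ (2 * n)) (grad G fun y ↦ 2⁻¹ * (G y ⬝ᵥ G y)) x =
    mvfderiv (𝓡∂ (2 * n)) G x := hgrad.mfderiv_eq
  rw [isMorseAt_im_iff hG hx hf, hd]
  exact fun _ ↦ hx

lemma exists_nhds_morseCandidates_nonempty (hcharts : X.HasGlobalHolomorphicCharts) (p : M) :
    ∃ K ∈ 𝓝 p, IsCompact K ∧ (X.morseCandidates p K).Nonempty := by
  have := Manifold.locallyCompact_of_finiteDimensional (M := M) (𝓡∂ (2 * n))
  obtain ⟨G, hG, hGp, hinv⟩ := hcharts.exists_coordinates p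
  obtain ⟨K, hK, hsub, hcomp⟩ := local_compact_nhds (eventually_isInvertible_mvfderiv
    ((contMDiff_of_mem_holMaps hG p).of_le (by simp)) hinv)
  refine ⟨K, hK, hcomp, fun y ↦ 2⁻¹ * (G y ⬝ᵥ G y),
    (X.holCSubalgebra ∞).smul_mem (dotProduct_mem_hol hG hG) (2⁻¹ : ℂ), ?_,
    fun x hx ↦ isMorseAt_im_half_dotProduct_self hG (hsub hx)⟩
  rw [mvfderiv_half_dotProduct_self hG, hGp, map_zero, ContinuousLinearMap.zero_comp]

lemma exists_nhds_morseCandidates_union_nonempty (hcharts : X.HasGlobalHolomorphicCharts)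
    (hsep : X.HolomorphicallySeparable) (hqp : q ≠ p) :
    ∃ t ∈ 𝓝 q, IsCompact t ∧ ∀ K, IsCompact K → (X.morseCandidates p K).Nonempty →
      (X.morseCandidates p (K ∪ t)).Nonempty := by
  have := Manifold.locallyCompact_of_finiteDimensional (M := M) (𝓡∂ (2 * n))
  obtain ⟨F, hF, hFp, hinv⟩ := exists_coordinates_of_ne hcharts hsep hqp
  obtain ⟨t, ht, hsub, hcomp⟩ := local_compact_nhds
    ((eventually_isInvertible_mvfderiv ((contMDiff_of_mem_holMaps hF q).of_le (by simp)) hinv).and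
      (chart_source_mem_nhds (EuclideanHalfSpace (2 * n)) q))
  refine ⟨t, ht, hcomp, fun K hK ⟨f, hf, hfp, hfK⟩ ↦ ?_⟩
  obtain ⟨a, ha, haK⟩ := (dense_setOf_forall_isMorseAt_im_add_dotProduct hF hf
    (fun x hx ↦ (hsub hx).2) fun x hx ↦ (hsub hx).1).inter_nhds_nonempty
      (eventually_forall_isMorseAt_im_add_dotProduct hcharts hf hF hK hfK)
  refine ⟨fun x ↦ f x + a ⬝ᵥ F x, add_dotProduct_mem_hol hf hF a, ?_,
    fun x hx ↦ hx.elim (haK x) (ha x)⟩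
  have hFx := mdifferentiableAt_of_mem_holMaps hF p
  have hFa := mvfderiv_clm_comp (dotProductCLM n a) hFx
  rw [hFp, ContinuousLinearMap.comp_zero] at hFa
  have hFd : MDifferentiableAt (𝓡∂ (2 * n)) 𝓘(ℝ, ℂ) (fun y ↦ dotProductCLM n a (F y)) p :=
    (dotProductCLM n a).mdifferentiableAt.comp p hFx
  exact (mvfderiv_fun_add (mdifferentiableAt_of_mem_hol hf p) hFd).trans
    (by rw [hfp, hFa, add_zero])

lemma morseCandidates_univ_nonempty [CompactSpace M] (hcharts : X.HasGlobalHolomorphicCharts)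
    (hsep : X.HolomorphicallySeparable) (p : M) : (X.morseCandidates p univ).Nonempty := by
  obtain ⟨K, hK, hKcomp, hKne⟩ := exists_nhds_morseCandidates_nonempty hcharts p
  have hext (q : M) : ∃ t ∈ 𝓝 q, IsCompact t ∧ ∀ L, IsCompact L → K ⊆ L →
      (X.morseCandidates p L).Nonempty → (X.morseCandidates p (L ∪ t)).Nonempty := by
    rcases eq_or_ne q p with rfl | hqp
    · exact ⟨K, hK, hKcomp, fun L _ hKL hL ↦ by rwa [union_eq_left.2 hKL]⟩
    · obtain ⟨t, ht, htcomp, hext⟩ := exists_nhds_morseCandidates_union_nonempty hcharts hsep hqp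
      exact ⟨t, ht, htcomp, fun L hL _ ↦ hext L hL⟩
  choose t ht htcomp hext using hext
  have hfinite (s : Finset M) : (X.morseCandidates p (K ∪ ⋃ q ∈ s, t q)).Nonempty := by
    classical
    induction s using Finset.induction_on with
    | empty => simpa using hKne
    | insert q s _ ih =>
      have hcomp := hKcomp.union (s.isCompact_biUnion fun q _ ↦ htcomp q)
      rw [Finset.set_biUnion_insert, union_comm (t q), ← union_assoc]
      exact hext q _ hcomp subset_union_left ih
  obtain ⟨s, hs⟩ := CompactSpace.elim_nhds_subcover t ht
  have hsM := hfinite s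
  rwa [hs, top_eq_univ, union_univ] at hsM

lemma finite_setOf_isCriticalPoint_im [CompactSpace M] (hcharts : X.HasGlobalHolomorphicCharts)
    (hf : f ∈ X.hol) (hmorse : ∀ x, IsMorseAt (n := n) (fun y ↦ (f y).im) x) :
    {x | IsCriticalPoint (n := n) (fun y ↦ (f y).im) x}.Finite := by
  by_contra hinf
  obtain ⟨x, hx⟩ := Set.Infinite.exists_accPt_principal hinf
  refine accPt_iff_frequently_nhdsNE.1 hx ?_
  obtain ⟨G, hG, -, hGx⟩ := hcharts.exists_coordinates x
  have hgrad := contMDiffAt_grad hG hGx hf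
  have hne : ∀ᶠ y in 𝓝[≠] x, grad G f y ≠ 0 := by
    rcases eq_or_ne (grad G f x) 0 with hcrit | hcrit
    · exact eventually_ne_of_isInvertible_mvfderiv (hgrad.mdifferentiableAt (by simp))
        ((isMorseAt_im_iff hG hGx hf).1 (hmorse x) hcrit) 0
    · exact eventually_nhdsWithin_of_eventually_nhds (hgrad.continuousAt.eventually_ne hcrit)
  filter_upwards [hne, mem_nhdsWithin_of_mem_nhds (eventually_isInvertible_mvfderiv
    ((contMDiff_of_mem_holMaps hG x).of_le (by simp)) hGx)] with y hy hGy
  rwa [isCriticalPoint_im_iff hG hGy hf]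

end Existence

end ComplexBdry

end

theorem mainTheorem2_general {n : ℕ} [NeZero n] {M : Type*} [TopologicalSpace M]
    [CompactSpace M] [ChartedSpace (EuclideanHalfSpace (2 * n)) M]
    [IsManifold (𝓡∂ (2 * n)) ∞ M] (X : ComplexBdry.ComplexStructure n M)
    (hcharts : X.HasGlobalHolomorphicCharts) (hsep : X.HolomorphicallySeparable) (p : M) :
    ∃ Φ ∈ X.hol, ∃ a ∈ X.hol,
      mfderiv (𝓡∂ (2 * n)) 𝓘(ℝ, ℂ) Φ p = 0 ∧
      ComplexBdry.IsMorse (n := n) (fun x ↦ (Φ x).im) ∧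
      {q : M | ComplexBdry.IsCriticalPoint (n := n) (fun x ↦ (Φ x).im) q}.Finite ∧
      a p = 1 ∧
      (∀ q : M, ComplexBdry.IsCriticalPoint (n := n) (fun x ↦ (Φ x).im) q → q ≠ p → a q = 0) ∧
      ∀ c : ℂ, (fun x ↦ Complex.exp (c * Φ x) * a x) ∈ X.hol := by
  obtain ⟨Φ, hΦ, hΦp, hmorse⟩ := ComplexBdry.morseCandidates_univ_nonempty hcharts hsep p
  have hfin := ComplexBdry.finite_setOf_isCriticalPoint_im hcharts hΦ fun x ↦
    hmorse x (Set.mem_univ x)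
  obtain ⟨a, ha, hap, haq⟩ := ComplexBdry.exists_mem_hol_eq_one_eq_zero hsep p hfin
  have hC2 : ContMDiff (𝓡∂ (2 * n)) 𝓘(ℝ, ℝ) 2 fun x ↦ (Φ x).im :=
    Complex.imCLM.contMDiff.comp (hΦ.1.of_le ENat.LEInfty.out)
  exact ⟨Φ, hΦ, a, ha, hΦp, ⟨hC2, fun x ↦ hmorse x (Set.mem_univ x)⟩, hfin, hap, haq, fun c ↦
    (X.holCSubalgebra ∞).mul_mem
      (ComplexBdry.ComplexStructure.exp_mem_holC ((X.holCSubalgebra ∞).smul_mem hΦ c)) ha⟩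

theorem mainTheorem2 {n : ℕ} [NeZero n] {M : Type*} [TopologicalSpace M] [T2Space M]
    [CompactSpace M] [ChartedSpace (EuclideanHalfSpace (2 * n)) M]
    [IsManifold (𝓡∂ (2 * n)) ∞ M] (X : ComplexBdry.ComplexStructure n M)
    (hcharts : X.HasGlobalHolomorphicCharts) (hsep : X.HolomorphicallySeparable)
    (k : ℕ) (hk : 2 ≤ k) :
    ∃ S : Set M, Dense S ∧ ∀ p ∈ S, ∃ Φ a : M → ℂ,
      Φ ∈ X.holC k ∧
      mfderiv (𝓡∂ (2 * n)) 𝓘(ℝ, ℂ) Φ p = 0 ∧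
      ComplexBdry.IsMorse (n := n) (fun x => (Φ x).im) ∧
      {q : M | ComplexBdry.IsCriticalPoint (n := n) (fun x => (Φ x).im) q}.Finite ∧
      a ∈ X.hol ∧
      a p = 1 ∧
      (∀ q : M, ComplexBdry.IsCriticalPoint (n := n) (fun x => (Φ x).im) q → q ≠ p → a q = 0) ∧
      ∀ h : ℝ, 0 < h →
        (fun x => Complex.exp (Φ x / h) * a x) ∈ X.holC k ∧
        (fun x => Complex.exp (-Φ x / h) * a x) ∈ X.holC k := by
  have hkC : X.hol ⊆ X.holC k := ComplexBdry.ComplexStructure.hol_subset_holC ENat.LEInfty.out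
  refine ⟨Set.univ, dense_univ, fun p _ ↦ ?_⟩
  obtain ⟨Φ, hΦ, a, ha, hcrit, hmorse, hfin, hap, haq, hexp⟩ :=
    mainTheorem2_general X hcharts hsep p
  refine ⟨Φ, a, hkC hΦ, hcrit, hmorse, hfin, ha, hap, haq, fun h _ ↦ ⟨?_, ?_⟩⟩
  · simpa only [div_eq_inv_mul] using hkC (hexp (h : ℂ)⁻¹)
  · simpa only [neg_mul, mul_neg, div_eq_inv_mul] using hkC (hexp (-(h : ℂ)⁻¹))
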